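/- Conventions. A real semisimple Lie algebra $\mathfrak g$ (finite dimensional, compact ideals allowed) is of Hermitian type, or a Hermitian Lie algebra, if it has a Cartan decomposition $\mathfrak g=\mathfrak k+\mathfrak p$ (that is, $[\mathfrak k,\mathfrak p]\subset\mathfrak p$, $[\mathfrak p,\mathfrak p]\subset\mathfrak k$ for the subalgebra $\mathfrak k$, and the Killing form is negative definite on $\mathfrak k$ and positive definite on $\mathfrak p$) and an element $Z$ of the centre of $\mathfrak k$ with $\mathrm{ad}(Z)^2=-1$ on $\mathfrak p$; such a $Z$ is called a complex structure. A homomorphism $\rho\colon\mathfrak g_1\to\mathfrak g_2$ of Hermitian Lie algebras with complex structures $Z_1,Z_2$ is holomorphic (corresponds to a holomorphic map of the associated Hermitian symmetric spaces) if $\rho\circ\mathrm{ad}(Z_1)=\mathrm{ad}(Z_2)\circ\rho$. Theorem. Let $\mathfrak g$ be a Hermitian Lie algebra with Cartan decomposition $\mathfrak g=\mathfrak k+\mathfrak p$ and complex structure $Z$. Let $\mathfrak h\subset\mathfrak k$ be a maximal abelian subalgebra of $\mathfrak k$, so that $\mathfrak h_{\mathbb C}$ is a Cartan subalgebra of $\mathfrak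 g_{\mathbb C}$, and let $\mathfrak g_{\mathbb C}=\mathfrak h_{\mathbb C}+\sum_{\alpha\in\Delta}\mathfrak g_\alpha$ be the root space decomposition. Let $\Gamma'\subset\Delta$ be a Dynkin $\Pi$-system, that is, a linearly independent set of roots with $\alpha-\beta\notin\Delta$ for all $\alpha,\beta\in\Gamma'$. Put $\Delta(\Gamma')=\mathrm{span}_{\mathbb Z}(\Gamma')\cap\Delta$ and $\mathfrak g_{\mathbb C}(\Gamma')=\mathfrak h'_{\mathbb C}+\sum_{\alpha\in\Delta(\Gamma')}\mathfrak g_\alpha$, where $\mathfrak h'_{\mathbb C}$ is spanned by the coroots of the roots in $\Delta(\Gamma')$. Then the subalgebra $\mathfrak g(\Gamma')=\mathfrak g_{\mathbb C}(\Gamma')\cap\mathfrak g$ of $\mathfrak g$ is of Hermitian type, with Cartan decomposition $\mathfrak g(\Gamma')=(\mathfrak g(\Gamma')\cap\mathfrak k)+(\mathfrak g(\Gamma')\cap\mathfrak p)$, and there is exactly one complex structure $Z'$ on $\mathfrak g(\Gamma')$ with respect to this Cartan decomposition such that the inclusion $\mathfrak g(\Gamma')\hookrightarrow\mathfrak g$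 is holomorphic. -/

import Mathlib

open scoped TensorProduct

namespace HermitianLie

section RegularSubalgebra

open LieAlgebra LieAlgebra.IsKilling LieModule

variable {L : Type*} [LieRing L] [LieAlgebra ℂ L] [FiniteDimensional ℂ L]
  {H : LieSubalgebra ℂ L} [H.IsCartanSubalgebra]

/-- The root `α`, as a linear form on the Cartan subalgebra `H`. -/
noncomputable def rootForm (α : H.root) : Module.Dual ℂ H := (α : Weight ℂ H L).toLinear

/-- Dynkin `Π`-systems: linearly independent sets of roots such that no difference of two of their
elements is a root. Restriction to the real form `H₀ = {A ∈ H | α(A) ∈ ℝ for all roots α}`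
identifies the real span of the roots inside the dual of `H` with the real dual of `H₀`, so linear
independence in the Euclidean space of the root system is linear independence over `ℝ` here. -/
structure IsPiSystem (Γ : Set H.root) : Prop where
  linearIndependent : LinearIndependent ℝ (fun α : Γ ↦ rootForm (α : H.root))
  sub_ne_root : ∀ α ∈ Γ, ∀ β ∈ Γ, ∀ γ : H.root, rootForm α - rootForm β ≠ rootForm γ

/-- `Δ(Γ) = span_ℤ(Γ) ∩ Δ`. -/
def subrootSystem (Γ : Set H.root) : Set H.root :=
  {α | rootForm α ∈ Submodule.span ℤ (rootForm '' Γ)}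

variable [IsKilling ℂ L]

/-- The subspace `𝔥' + ∑_{α ∈ Δ(Γ)} 𝔤_α`, where `𝔥'` is spanned by the coroots of `Δ(Γ)`. -/
noncomputable def regularSubmodule (Γ : Set H.root) : Submodule ℂ L :=
  Submodule.span ℂ ((fun α : H.root ↦ ((coroot (α : Weight ℂ H L) : H) : L)) '' subrootSystem Γ) ⊔
    ⨆ α ∈ subrootSystem Γ, (rootSpace H (α : Weight ℂ H L)).toSubmodule

lemma coroot_mem_regularSubmodule {Γ : Set H.root} {α : H.root} (hα : α ∈ subrootSystem Γ) :
    ((coroot (α : Weight ℂ H L) : H) : L) ∈ regularSubmodule Γ :=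
  Submodule.mem_sup_left (Submodule.subset_span ⟨α, hα, rfl⟩)

lemma rootSpace_le_regularSubmodule {Γ : Set H.root} {α : H.root} (hα : α ∈ subrootSystem Γ) :
    (rootSpace H (α : Weight ℂ H L)).toSubmodule ≤ regularSubmodule Γ :=
  le_trans (le_iSup₂_of_le α hα le_rfl) le_sup_right

lemma regularSubmodule_le {Γ : Set H.root} {S : Submodule ℂ L}
    (h₁ : ∀ α ∈ subrootSystem Γ, ((coroot (α : Weight ℂ H L) : H) : L) ∈ S)
    (h₂ : ∀ α ∈ subrootSystem Γ, ∀ x ∈ rootSpace H (α : Weight ℂ H L), x ∈ S) :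
    regularSubmodule Γ ≤ S := by
  refine sup_le (Submodule.span_le.mpr ?_) (iSup₂_le fun α hα x hx ↦ h₂ α hα x hx)
  rintro _ ⟨α, hα, rfl⟩
  exact h₁ α hα

lemma lie_mem_regularSubmodule_of_rootSpace {Γ : Set H.root} {α β : H.root}
    (hα : α ∈ subrootSystem Γ) (hβ : β ∈ subrootSystem Γ) {x y : L}
    (hx : x ∈ rootSpace H (α : Weight ℂ H L)) (hy : y ∈ rootSpace H (β : Weight ℂ H L)) :
    ⁅x, y⁆ ∈ regularSubmodule Γ := by
  by_cases h0 : ((α : Weight ℂ H L) : H → ℂ) + (β : Weight ℂ H L) = 0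
  · have hβ' : ((β : Weight ℂ H L) : H → ℂ) = -((α : Weight ℂ H L) : H → ℂ) :=
      (neg_eq_of_add_eq_zero_right h0).symm
    rw [hβ'] at hy
    have hmem : ⟨⁅x, y⁆, _⟩ ∈ corootSpace ((α : Weight ℂ H L) : H → ℂ) :=
      (mem_corootSpace' (x := ⟨⁅x, y⁆, by
        have := lie_mem_genWeightSpace_of_mem_genWeightSpace hx hy
        rw [add_neg_cancel] at this
        simpa using this⟩) _).mpr (Submodule.subset_span ⟨x, hx, y, hy, rfl⟩)
    have h2 := (coe_corootSpace_eq_span_singleton (α : Weight ℂ H L)).le hmem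
    obtain ⟨c, hc⟩ := Submodule.mem_span_singleton.mp h2
    have hc' : c • ((coroot (α : Weight ℂ H L) : H) : L) = ⁅x, y⁆ := congrArg Subtype.val hc
    rw [← hc']
    exact Submodule.smul_mem _ _ (coroot_mem_regularSubmodule hα)
  · have hxy := lie_mem_genWeightSpace_of_mem_genWeightSpace hx hy
    by_cases hb : rootSpace H (((α : Weight ℂ H L) : H → ℂ) + (β : Weight ℂ H L)) = ⊥
    · have hz : ⁅x, y⁆ = 0 := by
        have h3 : ⁅x, y⁆ ∈ rootSpace H (((α : Weight ℂ H L) : H → ℂ) + (β : Weight ℂ H L)) := hxy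
        rw [hb] at h3
        simpa using h3
      rw [hz]
      exact zero_mem _
    · let γ : Weight ℂ H L := ⟨_, hb⟩
      have hγ : γ.IsNonZero := fun h ↦ h0 h
      let γ' : H.root := ⟨γ, by simpa using hγ⟩
      have hmem : γ' ∈ subrootSystem Γ := by
        have : rootForm γ' = rootForm α + rootForm β := by
          ext z; rfl
        change rootForm γ' ∈ Submodule.span ℤ (rootForm '' Γ)
        rw [this]
        exact add_mem hα hβ
      exact rootSpace_le_regularSubmodule hmem hxy

lemma lie_mem_regularSubmodule {Γ : Set H.root} {x y : L}
    (hx : x ∈ regularSubmodule Γ) (hy : y ∈ regularSubmodule Γ) :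
    ⁅x, y⁆ ∈ regularSubmodule Γ := by
  have key : regularSubmodule Γ ≤
      (regularSubmodule Γ).comap (ad ℂ L x : L →ₗ[ℂ] L) := by
    have hx' : ∀ w ∈ regularSubmodule Γ, regularSubmodule Γ ≤
        (regularSubmodule Γ).comap (ad ℂ L w : L →ₗ[ℂ] L) := by
      intro w hw
      refine regularSubmodule_le (fun β hβ ↦ ?_) (fun β hβ v hv ↦ ?_)
      · rw [Submodule.mem_comap, ad_apply, ← lie_skew, neg_mem_iff]
        have hle : regularSubmodule Γ ≤ (regularSubmodule Γ).comap
            (ad ℂ L ((coroot (β : Weight ℂ H L) : H) : L) : L →ₗ[ℂ] L) := by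
          refine regularSubmodule_le (fun α _ ↦ ?_) (fun α hα v hv ↦ ?_)
          · have : ⁅coroot (β : Weight ℂ H L), coroot (α : Weight ℂ H L)⁆ = 0 :=
              trivial_lie_zero _ _ _ _
            have h' := congrArg Subtype.val this
            rw [Submodule.mem_comap, ad_apply]
            rw [LieSubalgebra.coe_bracket] at h'
            rw [h']
            exact zero_mem _
          · rw [Submodule.mem_comap, ad_apply]
            have := lie_eq_smul_of_mem_rootSpace hv (coroot (β : Weight ℂ H L))
            rw [LieSubalgebra.coe_bracket_of_module] at this
            rw [this]
            exact Submodule.smul_mem _ _ (rootSpace_le_regularSubmodule hα hv)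
        exact hle hw
      · rw [Submodule.mem_comap, ad_apply, ← lie_skew, neg_mem_iff]
        have hle : regularSubmodule Γ ≤ (regularSubmodule Γ).comap
            (ad ℂ L v : L →ₗ[ℂ] L) := by
          refine regularSubmodule_le (fun α _ ↦ ?_) (fun α hα u hu ↦ ?_)
          · rw [Submodule.mem_comap, ad_apply, ← lie_skew, neg_mem_iff]
            have := lie_eq_smul_of_mem_rootSpace hv (coroot (α : Weight ℂ H L))
            rw [LieSubalgebra.coe_bracket_of_module] at this
            rw [this]
            exact Submodule.smul_mem _ _ (rootSpace_le_regularSubmodule hβ hv)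
          · exact lie_mem_regularSubmodule_of_rootSpace hβ hα hv hu
        exact hle hw
    exact hx' x hx
  exact key hy

/-- The regular subalgebra `𝔤_ℂ(Γ) = 𝔥' + ∑_{α ∈ Δ(Γ)} 𝔤_α` of a complex semisimple Lie algebra. -/
noncomputable def regularSubalgebra (Γ : Set H.root) : LieSubalgebra ℂ L :=
  { regularSubmodule Γ with
    lie_mem' := lie_mem_regularSubmodule }

end RegularSubalgebra

section Hermitian

variable {g : Type*} [LieRing g] [LieAlgebra ℝ g]

/-- `g = k + p` is a Cartan decomposition of the real Lie algebra `g`. -/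
structure IsCartanDecomposition (k : LieSubalgebra ℝ g) (p : Submodule ℝ g) : Prop where
  isCompl : IsCompl k.toSubmodule p
  lie_mem_p : ∀ X ∈ k, ∀ Y ∈ p, ⁅X, Y⁆ ∈ p
  lie_mem_k : ∀ X ∈ p, ∀ Y ∈ p, ⁅X, Y⁆ ∈ k
  neg_on_k : ∀ X ∈ k, X ≠ 0 → killingForm ℝ g X X < 0
  pos_on_p : ∀ X ∈ p, X ≠ 0 → 0 < killingForm ℝ g X X

/-- `Z` is a complex structure for the Cartan decomposition `g = k + p`: an element of the centre
of `k` such that `ad(Z)` squares to `-1` on `p`. -/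
structure IsComplexStructure (k : LieSubalgebra ℝ g) (p : Submodule ℝ g) (Z : g) : Prop where
  mem : Z ∈ k
  central : ∀ X ∈ k, ⁅Z, X⁆ = 0
  sq : ∀ X ∈ p, ⁅Z, ⁅Z, X⁆⁆ = -X

variable (g) in
/-- `g` is a semisimple Lie algebra of Hermitian type: the symmetric space of the noncompact part
of `g` is Hermitian. Compact ideals are allowed. -/
def IsHermitianType : Prop :=
  LieAlgebra.IsSemisimple ℝ g ∧ ∃ (k : LieSubalgebra ℝ g) (p : Submodule ℝ g) (Z : g),
    IsCartanDecomposition k p ∧ IsComplexStructure k p Z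

/-- Condition (H1): the homomorphism `ρ` corresponds to a holomorphic map between the symmetric
spaces with complex structures `Z₁`, `Z₂`. -/
def IsHolomorphic {g₁ g₂ : Type*} [LieRing g₁] [LieAlgebra ℝ g₁] [LieRing g₂] [LieAlgebra ℝ g₂]
    (Z₁ : g₁) (Z₂ : g₂) (ρ : g₁ →ₗ⁅ℝ⁆ g₂) : Prop :=
  ∀ X : g₁, ρ ⁅Z₁, X⁆ = ⁅Z₂, ρ X⁆

/-- The real part of an element of the complexification of `g`. -/
noncomputable def rePart : ℂ ⊗[ℝ] g →ₗ[ℝ] g :=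
  TensorProduct.lid ℝ g ∘ₗ TensorProduct.map Complex.reLm LinearMap.id

/-- The imaginary part of an element of the complexification of `g`. -/
noncomputable def imPart : ℂ ⊗[ℝ] g →ₗ[ℝ] g :=
  TensorProduct.lid ℝ g ∘ₗ TensorProduct.map Complex.imLm LinearMap.id

@[simp] lemma rePart_tmul (c : ℂ) (X : g) : rePart (c ⊗ₜ[ℝ] X) = c.re • X := by simp [rePart]

@[simp] lemma imPart_tmul (c : ℂ) (X : g) : imPart (c ⊗ₜ[ℝ] X) = c.im • X := by simp [imPart]

lemma eq_rePart_add_imPart (x : ℂ ⊗[ℝ] g) :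
    x = (1 : ℂ) ⊗ₜ[ℝ] rePart x + Complex.I ⊗ₜ[ℝ] imPart x := by
  induction x with
  | zero => simp
  | tmul c X =>
    simp only [rePart_tmul, imPart_tmul, TensorProduct.tmul_smul, TensorProduct.smul_tmul',
      ← TensorProduct.add_tmul]
    congr 1
    apply Complex.ext <;> simp
  | add x y hx hy =>
    nth_rewrite 1 [hx, hy]
    simp only [map_add, TensorProduct.tmul_add]
    abel

lemma mem_baseChange_iff (s : Submodule ℝ g) (x : ℂ ⊗[ℝ] g) :
    x ∈ s.baseChange ℂ ↔ rePart x ∈ s ∧ imPart x ∈ s := by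
  constructor
  · intro hx
    rw [Submodule.baseChange_eq_span] at hx
    induction hx using Submodule.span_induction with
    | mem x hx =>
      obtain ⟨X, hX, rfl⟩ := hx
      have hX' : X ∈ s := hX
      simp [hX']
    | zero => simp
    | add x y _ _ hx hy => simp [add_mem, hx.1, hx.2, hy.1, hy.2]
    | smul c x _ hx =>
      rw [eq_rePart_add_imPart x]
      simp [TensorProduct.smul_tmul', add_mem, s.smul_mem, hx.1, hx.2]
  · rintro ⟨h₁, h₂⟩
    rw [eq_rePart_add_imPart x]
    exact add_mem (Submodule.tmul_mem_baseChange_of_mem _ h₁)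
      (Submodule.tmul_mem_baseChange_of_mem _ h₂)

@[simp] lemma rePart_lie (x y : ℂ ⊗[ℝ] g) :
    rePart ⁅x, y⁆ = ⁅rePart x, rePart y⁆ - ⁅imPart x, imPart y⁆ := by
  conv_lhs => rw [eq_rePart_add_imPart x, eq_rePart_add_imPart y]
  simp [add_lie, lie_add, sub_eq_add_neg]

@[simp] lemma imPart_lie (x y : ℂ ⊗[ℝ] g) :
    imPart ⁅x, y⁆ = ⁅rePart x, imPart y⁆ + ⁅imPart x, rePart y⁆ := by
  conv_lhs => rw [eq_rePart_add_imPart x, eq_rePart_add_imPart y]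
  simp [add_lie, lie_add, add_comm]

/-- The complexification of a real Lie subalgebra, as a subalgebra of the complexification. -/
noncomputable def complexify (s : LieSubalgebra ℝ g) : LieSubalgebra ℂ (ℂ ⊗[ℝ] g) :=
  { s.toSubmodule.baseChange ℂ with
    lie_mem' := by
      intro x y hx hy
      obtain ⟨a, b⟩ := (mem_baseChange_iff s.toSubmodule x).mp hx
      obtain ⟨c, d⟩ := (mem_baseChange_iff s.toSubmodule y).mp hy
      refine (mem_baseChange_iff s.toSubmodule ⁅x, y⁆).mpr ⟨?_, ?_⟩
      · rw [rePart_lie]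
        exact sub_mem (s.lie_mem a c) (s.lie_mem b d)
      · rw [imPart_lie]
        exact add_mem (s.lie_mem a d) (s.lie_mem b c) }

lemma mem_complexify_iff (s : LieSubalgebra ℝ g) (x : ℂ ⊗[ℝ] g) :
    x ∈ complexify s ↔ rePart x ∈ s ∧ imPart x ∈ s :=
  mem_baseChange_iff s.toSubmodule x

/-- `s ∩ g`: the real Lie subalgebra of those `X` in `g` that lie in the subalgebra `s` of the
complexification of `g`. -/
noncomputable def realPart (s : LieSubalgebra ℂ (ℂ ⊗[ℝ] g)) : LieSubalgebra ℝ g where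
  carrier := {X | (1 : ℂ) ⊗ₜ[ℝ] X ∈ s}
  add_mem' {X Y} hX hY := by
    simpa [TensorProduct.tmul_add] using add_mem (S := LieSubalgebra ℂ (ℂ ⊗[ℝ] g)) hX hY
  zero_mem' := by simp
  smul_mem' c X hX := by
    have := s.smul_mem (c : ℂ) hX
    simpa [TensorProduct.tmul_smul, TensorProduct.smul_tmul'] using this
  lie_mem' {X Y} hX hY := by
    simpa using s.lie_mem hX hY

/-- The complexification of a real semisimple Lie algebra is semisimple. -/
instance isKilling_complexification [FiniteDimensional ℝ g] [LieAlgebra.IsKilling ℝ g] :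
    LieAlgebra.IsKilling ℂ (ℂ ⊗[ℝ] g) := by
  refine ⟨(LieSubmodule.eq_bot_iff _).mpr fun x hx ↦ ?_⟩
  have hκ : ∀ W : g, killingForm ℝ g (rePart x) W = 0 ∧ killingForm ℝ g (imPart x) W = 0 := by
    intro W
    have h := (LieIdeal.mem_killingCompl ℂ (ℂ ⊗[ℝ] g) ⊤).mp hx ((1 : ℂ) ⊗ₜ[ℝ] W) trivial
    rw [killingForm, LieModule.traceForm_baseChange, eq_rePart_add_imPart x] at h
    have h' : (killingForm ℝ g W (rePart x) : ℂ)
        + (killingForm ℝ g W (imPart x) : ℂ) * Complex.I = 0 := by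
      simpa [killingForm, mul_comm] using h
    have hre := congrArg Complex.re h'
    have him := congrArg Complex.im h'
    exact ⟨(LieModule.traceForm_comm ℝ g g _ _).trans (by simpa using hre),
      (LieModule.traceForm_comm ℝ g g _ _).trans (by simpa using him)⟩
  have hz : ∀ X : g, (∀ W : g, killingForm ℝ g X W = 0) → X = 0 := by
    intro X hX
    have : X ∈ LinearMap.ker (killingForm ℝ g) := by
      rw [LinearMap.mem_ker]
      ext W
      exact hX W
    rw [LieAlgebra.IsKilling.ker_killingForm_eq_bot] at this
    simpa using this
  rw [eq_rePart_add_imPart x, hz _ fun W ↦ (hκ W).1, hz _ fun W ↦ (hκ W).2]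
  simp

/-- A Cartan decomposition `g = k + p` of `g`, a complex structure `Z` for it, and a maximal abelian
subalgebra `h` of `k`. A semisimple `g` with such data is a Hermitian Lie algebra. -/
structure HermitianDatum (g : Type*) [LieRing g] [LieAlgebra ℝ g] where
  k : LieSubalgebra ℝ g
  p : Submodule ℝ g
  Z : g
  h : LieSubalgebra ℝ g
  isCartanDecomposition : IsCartanDecomposition k p
  isComplexStructure : IsComplexStructure k p Z
  maximal_h : Maximal (fun a : LieSubalgebra ℝ g ↦ a ≤ k ∧ IsLieAbelian a) h

namespace HermitianDatum

variable (D : HermitianDatum g)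

/-- The complexification of `h`. -/
noncomputable abbrev hC : LieSubalgebra ℂ (ℂ ⊗[ℝ] g) := complexify D.h

lemma lie_eq_zero {X Y : g} (hX : X ∈ D.h) (hY : Y ∈ D.h) : ⁅X, Y⁆ = 0 := by
  have := D.maximal_h.prop.2
  have h' : ⁅(⟨X, hX⟩ : D.h), (⟨Y, hY⟩ : D.h)⁆ = 0 := trivial_lie_zero _ _ _ _
  simpa using congrArg Subtype.val h'

/-- An element of `k` that commutes with `h` lies in `h`. -/
lemma mem_h_of_commutes {X : g} (hX : X ∈ D.k) (hc : ∀ H ∈ D.h, ⁅X, H⁆ = 0) : X ∈ D.h := by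
  let a : LieSubalgebra ℝ g :=
    { D.h.toSubmodule ⊔ Submodule.span ℝ {X} with
      lie_mem' := by
        intro u v hu hv
        obtain ⟨u', hu', w, hw, rfl⟩ := Submodule.mem_sup.mp hu
        obtain ⟨v', hv', w', hw', rfl⟩ := Submodule.mem_sup.mp hv
        obtain ⟨c, rfl⟩ := Submodule.mem_span_singleton.mp hw
        obtain ⟨d, rfl⟩ := Submodule.mem_span_singleton.mp hw'
        have h1 : ⁅u', X⁆ = 0 := by rw [← lie_skew, hc u' hu', neg_zero]
        simp [D.lie_eq_zero hu' hv', h1, hc v' hv'] }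
  have hmem : ∀ u, u ∈ a ↔ u ∈ D.h.toSubmodule ⊔ Submodule.span ℝ {X} := fun _ ↦ Iff.rfl
  have ha : a ≤ D.k ∧ IsLieAbelian a := by
    refine ⟨fun u hu ↦ ?_, ⟨?_⟩⟩
    · obtain ⟨u', hu', w, hw, rfl⟩ := Submodule.mem_sup.mp ((hmem u).mp hu)
      obtain ⟨c, rfl⟩ := Submodule.mem_span_singleton.mp hw
      exact add_mem (D.maximal_h.prop.1 hu') (D.k.smul_mem c hX)
    · rintro ⟨u, hu⟩ ⟨v, hv⟩
      obtain ⟨u', hu', w, hw, rfl⟩ := Submodule.mem_sup.mp ((hmem u).mp hu)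
      obtain ⟨v', hv', w', hw', rfl⟩ := Submodule.mem_sup.mp ((hmem v).mp hv)
      obtain ⟨c, rfl⟩ := Submodule.mem_span_singleton.mp hw
      obtain ⟨d, rfl⟩ := Submodule.mem_span_singleton.mp hw'
      have h1 : ⁅u', X⁆ = 0 := by rw [← lie_skew, hc u' hu', neg_zero]
      apply Subtype.ext
      simp [D.lie_eq_zero hu' hv', h1, hc v' hv']
  have hle : D.h ≤ a := fun u hu ↦ (hmem u).mpr (Submodule.mem_sup_left hu)
  exact D.maximal_h.le_of_ge ha hle
    ((hmem X).mpr (Submodule.mem_sup_right (Submodule.mem_span_singleton_self X)))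

lemma Z_mem_h : D.Z ∈ D.h :=
  D.mem_h_of_commutes D.isComplexStructure.mem
    fun H hH ↦ D.isComplexStructure.central H (D.maximal_h.prop.1 hH)

lemma mem_h_of_normalizes {X : g} (hX : ∀ H ∈ D.h, ⁅X, H⁆ ∈ D.h) : X ∈ D.h := by
  have hk : X ∈ D.k := by
    obtain ⟨u, hu, v, hv, rfl⟩ := Submodule.mem_sup.mp
      (D.isCartanDecomposition.isCompl.codisjoint.eq_top.ge (Submodule.mem_top (x := X)))
    have h1 : ⁅D.Z, u + v⁆ ∈ D.k := by
      rw [← lie_skew]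
      exact neg_mem (D.maximal_h.prop.1 (hX _ D.Z_mem_h))
    rw [lie_add, D.isComplexStructure.central u hu, zero_add] at h1
    have h2 := D.isComplexStructure.central _ h1
    rw [D.isComplexStructure.sq v hv, neg_eq_zero] at h2
    rw [h2, add_zero]
    exact hu
  refine D.mem_h_of_commutes hk fun H hH ↦ ?_
  by_contra hne
  have hmem := hX H hH
  have := D.isCartanDecomposition.neg_on_k _ (D.maximal_h.prop.1 hmem) hne
  have h3 : killingForm ℝ g ⁅X, H⁆ ⁅X, H⁆ = 0 := by
    rw [killingForm, LieModule.traceForm_apply_lie_apply, D.lie_eq_zero hH hmem, map_zero]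
  exact this.ne h3

/-- `hC` is a Cartan subalgebra of the complexification of `g`. -/
instance : D.hC.IsCartanSubalgebra where
  nilpotent := by
    have : IsLieAbelian D.hC := by
      refine ⟨?_⟩
      rintro ⟨x, hx⟩ ⟨y, hy⟩
      obtain ⟨a, b⟩ := (mem_complexify_iff _ _).mp hx
      obtain ⟨c, d⟩ := (mem_complexify_iff _ _).mp hy
      apply Subtype.ext
      change ⁅x, y⁆ = 0
      rw [eq_rePart_add_imPart ⁅x, y⁆, rePart_lie, imPart_lie, D.lie_eq_zero a c,
        D.lie_eq_zero b d, D.lie_eq_zero a d, D.lie_eq_zero b c]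
      simp
    infer_instance
  self_normalizing := by
    refine le_antisymm (fun x hx ↦ ?_) (LieSubalgebra.le_normalizer _)
    rw [LieSubalgebra.mem_normalizer_iff] at hx
    have key : ∀ H ∈ D.h, ⁅rePart x, H⁆ ∈ D.h ∧ ⁅imPart x, H⁆ ∈ D.h := by
      intro H hH
      have h1 : (1 : ℂ) ⊗ₜ[ℝ] H ∈ D.hC := (mem_complexify_iff _ _).mpr (by simp [hH])
      simpa using (mem_complexify_iff _ _).mp (hx _ h1)
    exact (mem_complexify_iff _ _).mpr ⟨D.mem_h_of_normalizes fun H hH ↦ (key H hH).1,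
      D.mem_h_of_normalizes fun H hH ↦ (key H hH).2⟩

/-- The regular subalgebra `𝔤(Γ) = 𝔤_ℂ(Γ) ∩ g` of `g`. -/
noncomputable def realRegularSubalgebra [FiniteDimensional ℝ g] [LieAlgebra.IsSemisimple ℝ g]
    (Γ : Set D.hC.root) : LieSubalgebra ℝ g :=
  realPart (regularSubalgebra Γ)

end HermitianDatum

end Hermitian

end HermitianLie

/-! Write B for the Killing form, θ = 1 + 2 ad(Z)² for the Cartan involution. The form -B(X, θY) is
an inner product on g for which the adjoint of ad(X) is -ad(θX) (`innerForm_pos`,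
`innerForm_lie_left`).

Let s be a centreless subalgebra stable under ad(Z), hence under θ. The Killing form of s at (θX, X)
is minus the squared norm of ad(X) on s, so s inherits semisimplicity and the Cartan decomposition.
The derivation ad(Z) of s is then inner; the element of s inducing it is the required complex
structure, unique because s has no centre.

It remains to see that 𝔤(Γ) is such an s. Since Z lies in h and the root spaces are h_ℂ-stable,
ad(Z) preserves it. Roots are imaginary on h, so conjugation swaps the root spaces of α and -α and
𝔤_ℂ(Γ) lies in the complexification of 𝔤(Γ). As 𝔤_ℂ(Γ) is perfect, a central X of 𝔤(Γ) is
B-orthogonal to all of 𝔤(Γ), in particular to θX, so X = 0. -/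

namespace HermitianLie

/-! ### Positivity of traces -/

/-- If `B` is adjoint to `A ≠ 0` with respect to a positive definite symmetric form, then
`B ∘ A` has positive trace. -/
lemma trace_comp_pos_of_adjoint {V : Type*} [AddCommGroup V] [Module ℝ V] [FiniteDimensional ℝ V]
    (Q : LinearMap.BilinForm ℝ V) (hs : ∀ x y, Q x y = Q y x) (hp : ∀ x, x ≠ 0 → 0 < Q x x)
    {A B : V →ₗ[ℝ] V} (hAB : ∀ x y, Q (A x) y = Q x (B y)) (hA : A ≠ 0) :
    0 < LinearMap.trace ℝ V (B ∘ₗ A) := by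
  have hn : ∀ x, 0 ≤ Q x x := fun x ↦ by
    rcases eq_or_ne x 0 with rfl | hx
    · simp
    · exact (hp x hx).le
  let c : InnerProductSpace.Core ℝ V :=
    { inner := fun x y ↦ Q x y
      conj_inner_symm := fun x y ↦ hs y x
      re_inner_nonneg := hn
      add_left := fun x y z ↦ by simp
      smul_left := fun x y r ↦ by simp
      definite := fun x hx ↦ by
        by_contra h
        exact (hp x h).ne' hx }
  let : NormedAddCommGroup V := c.toNormedAddCommGroup
  let : InnerProductSpace ℝ V := InnerProductSpace.ofCore c.toCore
  let b := stdOrthonormalBasis ℝ V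
  have hi : ∀ x y : V, inner ℝ x y = Q x y := fun _ _ ↦ rfl
  rw [LinearMap.trace_eq_sum_inner _ b]
  -- In an orthonormal basis the trace becomes the sum of the squared lengths of the `A (b i)`.
  have hsum : ∀ i, inner ℝ (b i) ((B ∘ₗ A) (b i)) = Q (A (b i)) (A (b i)) := fun i ↦ by
    rw [hi, hAB]; rfl
  simp only [hsum]
  obtain ⟨i, hi⟩ : ∃ i, A (b i) ≠ 0 := by
    by_contra! h
    exact hA (b.toBasis.ext fun i ↦ by simpa using h i)
  exact Finset.sum_pos' (fun j _ ↦ hn _) ⟨i, Finset.mem_univ i, hp _ hi⟩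

variable {g : Type*} [LieRing g] [LieAlgebra ℝ g]

/-! ### Conjugation on the complexification, invariance of the Killing form -/

lemma ext_rePart_imPart {x y : ℂ ⊗[ℝ] g} (hr : rePart x = rePart y) (hi : imPart x = imPart y) :
    x = y := by
  rw [eq_rePart_add_imPart x, eq_rePart_add_imPart y, hr, hi]

@[simp] lemma rePart_smul (c : ℂ) (x : ℂ ⊗[ℝ] g) :
    rePart (c • x) = c.re • rePart x - c.im • imPart x := by
  conv_lhs => rw [eq_rePart_add_imPart x]
  simp [TensorProduct.smul_tmul', sub_eq_add_neg]

@[simp] lemma imPart_smul (c : ℂ) (x : ℂ ⊗[ℝ] g) :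
    imPart (c • x) = c.re • imPart x + c.im • rePart x := by
  conv_lhs => rw [eq_rePart_add_imPart x]
  simp [TensorProduct.smul_tmul', add_comm]

/-- The conjugation of the complexification of `g` with respect to `g`. -/
noncomputable def conj (x : ℂ ⊗[ℝ] g) : ℂ ⊗[ℝ] g :=
  (1 : ℂ) ⊗ₜ[ℝ] rePart x - Complex.I ⊗ₜ[ℝ] imPart x

@[simp] lemma rePart_conj (x : ℂ ⊗[ℝ] g) : rePart (conj x) = rePart x := by simp [conj]

@[simp] lemma imPart_conj (x : ℂ ⊗[ℝ] g) : imPart (conj x) = -imPart x := by simp [conj]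

lemma rePart_mem_realPart {s : LieSubalgebra ℂ (ℂ ⊗[ℝ] g)} {x : ℂ ⊗[ℝ] g} (hx : x ∈ s)
    (hc : conj x ∈ s) : rePart x ∈ realPart s := by
  have h : (1 : ℂ) ⊗ₜ[ℝ] rePart x = (1 / 2 : ℂ) • (x + conj x) := by
    refine ext_rePart_imPart ?_ ?_ <;> simp
    module
  change (1 : ℂ) ⊗ₜ[ℝ] rePart x ∈ s
  rw [h]
  exact s.smul_mem _ (add_mem hx hc)

lemma imPart_mem_realPart {s : LieSubalgebra ℂ (ℂ ⊗[ℝ] g)} {x : ℂ ⊗[ℝ] g} (hx : x ∈ s)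
    (hc : conj x ∈ s) : imPart x ∈ realPart s := by
  have h : (1 : ℂ) ⊗ₜ[ℝ] imPart x = (-(Complex.I / 2) : ℂ) • (x - conj x) := by
    refine ext_rePart_imPart ?_ ?_ <;> simp
    module
  change (1 : ℂ) ⊗ₜ[ℝ] imPart x ∈ s
  rw [h]
  exact s.smul_mem _ (sub_mem hx hc)

lemma killingForm_lie_left (X Y W : g) :
    killingForm ℝ g ⁅X, Y⁆ W = -killingForm ℝ g Y ⁅X, W⁆ := by
  rw [← lie_skew, map_neg, LinearMap.neg_apply, killingForm, LieModule.traceForm_apply_lie_apply]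

lemma killingForm_comm (X Y : g) : killingForm ℝ g X Y = killingForm ℝ g Y X :=
  LieModule.traceForm_comm ℝ g g X Y

/-! ### The Cartan involution and its inner product -/

namespace HermitianDatum

variable (D : HermitianDatum g)

lemma exists_add (X : g) : ∃ u ∈ D.k, ∃ v ∈ D.p, u + v = X :=
  Submodule.mem_sup.mp
    (D.isCartanDecomposition.isCompl.codisjoint.eq_top.ge (Submodule.mem_top (x := X)))

lemma lie_Z_of_mem_k {X : g} (hX : X ∈ D.k) : ⁅D.Z, X⁆ = 0 :=
  D.isComplexStructure.central X hX

lemma lie_lie_Z_of_mem_p {X : g} (hX : X ∈ D.p) : ⁅D.Z, ⁅D.Z, X⁆⁆ = -X :=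
  D.isComplexStructure.sq X hX

/-- The Cartan involution, written as `1 + 2 ad(Z)²`. -/
noncomputable def cartanInvolution : g →ₗ[ℝ] g :=
  LinearMap.id + (2 : ℝ) • (LieAlgebra.ad ℝ g D.Z * LieAlgebra.ad ℝ g D.Z)

lemma cartanInvolution_apply (X : g) :
    D.cartanInvolution X = X + (2 : ℝ) • ⁅D.Z, ⁅D.Z, X⁆⁆ := rfl

lemma cartanInvolution_of_mem_k {X : g} (hX : X ∈ D.k) : D.cartanInvolution X = X := by
  simp [cartanInvolution_apply, D.lie_Z_of_mem_k hX]

lemma cartanInvolution_of_mem_p {X : g} (hX : X ∈ D.p) : D.cartanInvolution X = -X := by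
  rw [cartanInvolution_apply, D.lie_lie_Z_of_mem_p hX]
  module

lemma cartanInvolution_cartanInvolution (X : g) :
    D.cartanInvolution (D.cartanInvolution X) = X := by
  obtain ⟨u, hu, v, hv, rfl⟩ := D.exists_add X
  simp [D.cartanInvolution_of_mem_k hu, D.cartanInvolution_of_mem_p hv]

/-- The bracket respects the ℤ/2-grading with even part k and odd part p. -/
lemma cartanInvolution_lie (X Y : g) :
    D.cartanInvolution ⁅X, Y⁆ = ⁅D.cartanInvolution X, D.cartanInvolution Y⁆ := by
  obtain ⟨u, hu, v, hv, rfl⟩ := D.exists_add X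
  obtain ⟨u', hu', v', hv', rfl⟩ := D.exists_add Y
  have h1 := D.cartanInvolution_of_mem_k (D.k.lie_mem hu hu')
  have h2 := D.cartanInvolution_of_mem_k (D.isCartanDecomposition.lie_mem_k v hv v' hv')
  have h3 := D.cartanInvolution_of_mem_p (D.isCartanDecomposition.lie_mem_p u hu v' hv')
  have h4 := D.cartanInvolution_of_mem_p (D.isCartanDecomposition.lie_mem_p u' hu' v hv)
  rw [← lie_skew, map_neg, neg_inj] at h4
  simp only [add_lie, lie_add, map_add, h1, h2, h3, h4, D.cartanInvolution_of_mem_k hu,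
    D.cartanInvolution_of_mem_p hv, D.cartanInvolution_of_mem_k hu',
    D.cartanInvolution_of_mem_p hv', lie_neg, neg_lie]
  abel

/-- The form `-B(X, θ Y)`, where `B` is the Killing form and `θ` the Cartan involution. -/
noncomputable def innerForm : LinearMap.BilinForm ℝ g :=
  -(killingForm ℝ g).compl₂ D.cartanInvolution

lemma innerForm_apply (X Y : g) :
    D.innerForm X Y = -killingForm ℝ g X (D.cartanInvolution Y) := rfl

/-- Skewness of ad(Z) for the Killing form turns θ = 1 + 2 ad(Z)² into an expression visibly
symmetric in X and Y. -/
lemma innerForm_eq (X Y : g) : D.innerForm X Y =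
    -killingForm ℝ g X Y + 2 * killingForm ℝ g ⁅D.Z, X⁆ ⁅D.Z, Y⁆ := by
  rw [innerForm_apply, cartanInvolution_apply, killingForm_lie_left]
  simp
  ring

lemma innerForm_comm (X Y : g) : D.innerForm X Y = D.innerForm Y X := by
  rw [innerForm_eq, innerForm_eq, killingForm_comm X, killingForm_comm ⁅D.Z, X⁆]

/-- Y is -ad(Z)² Y; by invariance one ad(Z) moves over to X, which it kills. -/
lemma killingForm_eq_zero {X Y : g} (hX : X ∈ D.k) (hY : Y ∈ D.p) : killingForm ℝ g X Y = 0 := by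
  have h := killingForm_lie_left D.Z X ⁅D.Z, Y⁆
  rw [D.lie_Z_of_mem_k hX, D.lie_lie_Z_of_mem_p hY] at h
  simpa using h.symm

lemma innerForm_pos {X : g} (hX : X ≠ 0) : 0 < D.innerForm X X := by
  obtain ⟨u, hu, v, hv, rfl⟩ := D.exists_add X
  have h : D.innerForm (u + v) (u + v) = -killingForm ℝ g u u + killingForm ℝ g v v := by
    rw [innerForm_apply, map_add D.cartanInvolution, D.cartanInvolution_of_mem_k hu,
      D.cartanInvolution_of_mem_p hv]
    simp [D.killingForm_eq_zero hu hv, killingForm_comm v u, add_comm]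
  rw [h]
  rcases eq_or_ne u 0 with rfl | hu0
  · simpa using D.isCartanDecomposition.pos_on_p v hv (by simpa using hX)
  · have h1 := D.isCartanDecomposition.neg_on_k u hu hu0
    rcases eq_or_ne v 0 with rfl | hv0
    · simpa using h1
    · linarith [D.isCartanDecomposition.pos_on_p v hv hv0]

/-- Invariance of the Killing form, together with θ being an involutive automorphism, makes -ad(θX)
the adjoint of ad(X). -/
lemma innerForm_lie_left (X Y W : g) :
    D.innerForm ⁅X, Y⁆ W = D.innerForm Y (-⁅D.cartanInvolution X, W⁆) := by
  rw [innerForm_apply, innerForm_apply, killingForm_lie_left, map_neg, cartanInvolution_lie,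
    cartanInvolution_cartanInvolution, map_neg]

lemma cartanInvolution_mem {s : LieSubalgebra ℝ g} (hZ : ∀ X ∈ s, ⁅D.Z, X⁆ ∈ s) {X : g} (hX : X ∈ s) :
    D.cartanInvolution X ∈ s := by
  rw [cartanInvolution_apply]
  exact add_mem hX (s.smul_mem _ (hZ _ (hZ _ hX)))

lemma one_tmul_mem_hC {H : g} (hH : H ∈ D.h) : (1 : ℂ) ⊗ₜ[ℝ] H ∈ D.hC :=
  (mem_complexify_iff _ _).mpr (by simp [hH])

/-- If `x` is an eigenvector of `ad(H)` with `H ∈ k`, then the eigenvalue is imaginary. -/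
lemma re_eq_zero_of_lie_eq_smul {H : g} (hH : H ∈ D.k) {x : ℂ ⊗[ℝ] g} (hx : x ≠ 0) {c : ℂ}
    (h : ⁅(1 : ℂ) ⊗ₜ[ℝ] H, x⁆ = c • x) : c.re = 0 := by
  have hre := congrArg rePart h
  have him := congrArg imPart h
  simp only [rePart_lie, imPart_lie, rePart_tmul, imPart_tmul, rePart_smul, imPart_smul,
    Complex.one_re, Complex.one_im, one_smul, zero_smul, zero_lie, sub_zero, add_zero] at hre him
  -- θ fixes H, so ad(H) is skew for the inner product.
  have hskew : ∀ Y, D.innerForm ⁅H, Y⁆ Y = 0 := fun Y ↦ by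
    have h1 := D.innerForm_lie_left H Y Y
    rw [D.cartanInvolution_of_mem_k hH, map_neg, D.innerForm_comm Y] at h1
    linarith
  have h1 := hskew (rePart x)
  have h2 := hskew (imPart x)
  rw [hre] at h1
  rw [him] at h2
  simp only [map_sub, map_add, map_smul, LinearMap.sub_apply, LinearMap.add_apply,
    LinearMap.smul_apply, smul_eq_mul, D.innerForm_comm (imPart x) (rePart x)] at h1 h2
  -- The cross terms with `c.im` cancel in the sum of the two equations.
  have h3 : c.re * (D.innerForm (rePart x) (rePart x) + D.innerForm (imPart x) (imPart x)) = 0 := by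
    linarith
  have hn : ∀ Y, 0 ≤ D.innerForm Y Y := fun Y ↦ by
    rcases eq_or_ne Y 0 with rfl | hY
    · simp
    · exact (D.innerForm_pos hY).le
  refine (mul_eq_zero.mp h3).resolve_right fun h4 ↦ hx (ext_rePart_imPart ?_ ?_)
  · by_contra h5
    rw [map_zero] at h5
    linarith [D.innerForm_pos h5, hn (imPart x)]
  · by_contra h5
    rw [map_zero] at h5
    linarith [D.innerForm_pos h5, hn (rePart x)]

end HermitianDatum

end HermitianLie

namespace HermitianLie

namespace HermitianDatum

/-! ### Centreless subalgebras stable under ad(Z) -/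

section StableSubalgebra

variable {g : Type*} [LieRing g] [LieAlgebra ℝ g] [FiniteDimensional ℝ g]
  (D : HermitianDatum g) {s : LieSubalgebra ℝ g}

/-- The Killing form of a centreless `ad(Z)`-stable subalgebra is definite in the same sense as the
one of `g`. -/
lemma killingForm_cartanInvolution_neg (hZ : ∀ X ∈ s, ⁅D.Z, X⁆ ∈ s)
    (hc : ∀ X ∈ s, (∀ Y ∈ s, ⁅X, Y⁆ = 0) → X = 0) {X : s} (hX : X ≠ 0) :
    killingForm ℝ s ⟨D.cartanInvolution X, D.cartanInvolution_mem hZ X.2⟩ X < 0 := by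
  -- The inner product restricts to s, where ad(X) still has adjoint -ad(θX); it is nonzero because
  -- s has no centre.
  have h := trace_comp_pos_of_adjoint (D.innerForm.restrict s.toSubmodule)
    (A := LieAlgebra.ad ℝ s X)
    (B := -LieAlgebra.ad ℝ s ⟨D.cartanInvolution X, D.cartanInvolution_mem hZ X.2⟩)
    (fun x y ↦ D.innerForm_comm x y)
    (fun x hx ↦ D.innerForm_pos fun h0 ↦ hx (Subtype.ext h0))
    (fun x y ↦ D.innerForm_lie_left X x y)
    (fun h0 ↦ hX <| Subtype.ext <| hc X X.2 fun Y hY ↦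
      congrArg Subtype.val (LinearMap.congr_fun h0 ⟨Y, hY⟩))
  rw [LinearMap.neg_comp, map_neg] at h
  rw [killingForm_apply_apply]
  exact neg_pos.mp h

lemma isKilling_of_lie_Z_mem (hZ : ∀ X ∈ s, ⁅D.Z, X⁆ ∈ s)
    (hc : ∀ X ∈ s, (∀ Y ∈ s, ⁅X, Y⁆ = 0) → X = 0) : LieAlgebra.IsKilling ℝ s := by
  refine ⟨(LieSubmodule.eq_bot_iff _).mpr fun X hX ↦ ?_⟩
  by_contra h0
  exact (D.killingForm_cartanInvolution_neg hZ hc h0).ne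
    ((LieIdeal.mem_killingCompl ℝ s ⊤).mp hX _ trivial)

/-- The two signs follow from negativity at (θX, X), as θ is 1 on k and -1 on p. -/
lemma isCartanDecomposition_of_lie_Z_mem (hZ : ∀ X ∈ s, ⁅D.Z, X⁆ ∈ s)
    (hc : ∀ X ∈ s, (∀ Y ∈ s, ⁅X, Y⁆ = 0) → X = 0) :
    IsCartanDecomposition (D.k.comap s.incl) (D.p.comap s.toSubmodule.subtype) where
  isCompl := by
    refine IsCompl.of_eq ((Submodule.eq_bot_iff _).mpr fun X hX ↦ ?_)
      (eq_top_iff.mpr fun X _ ↦ ?_)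
    · exact Subtype.ext (Submodule.disjoint_def.mp D.isCartanDecomposition.isCompl.disjoint
        X hX.1 hX.2)
    · obtain ⟨u, hu, v, hv, huv⟩ := D.exists_add (X : g)
      have hv' : v ∈ s := by
        -- The p-component of X is -ad(Z)² X, hence lies in s.
        have h := neg_mem (hZ _ (hZ _ X.2))
        rw [← huv, lie_add, D.lie_Z_of_mem_k hu, zero_add, D.lie_lie_Z_of_mem_p hv, neg_neg] at h
        exact h
      have hu' : u ∈ s := by
        rw [eq_sub_of_add_eq huv]
        exact sub_mem X.2 hv'
      exact Submodule.mem_sup.mpr ⟨⟨u, hu'⟩, hu, ⟨v, hv'⟩, hv, Subtype.ext huv⟩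
  lie_mem_p X hX Y hY := D.isCartanDecomposition.lie_mem_p X hX Y hY
  lie_mem_k X hX Y hY := D.isCartanDecomposition.lie_mem_k X hX Y hY
  neg_on_k X hX h0 := by
    have h := D.killingForm_cartanInvolution_neg hZ hc h0
    have hX' : (⟨D.cartanInvolution X, D.cartanInvolution_mem hZ X.2⟩ : s) = X :=
      Subtype.ext (D.cartanInvolution_of_mem_k hX)
    rwa [hX'] at h
  pos_on_p X hX h0 := by
    have h := D.killingForm_cartanInvolution_neg hZ hc h0
    have hX' : (⟨D.cartanInvolution X, D.cartanInvolution_mem hZ X.2⟩ : s) = -X :=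
      Subtype.ext (D.cartanInvolution_of_mem_p hX)
    rw [hX', map_neg, LinearMap.neg_apply] at h
    exact neg_neg_iff_pos.mp h

/-- The derivation `ad(Z)` of an `ad(Z)`-stable subalgebra. -/
noncomputable def derivationZ (hZ : ∀ X ∈ s, ⁅D.Z, X⁆ ∈ s) : LieDerivation ℝ s s where
  toLinearMap := (LieAlgebra.ad ℝ g D.Z : g →ₗ[ℝ] g).restrict hZ
  leibniz' a b := Subtype.ext <| by
    change ⁅D.Z, ⁅(a : g), (b : g)⁆⁆ = ⁅(a : g), ⁅D.Z, (b : g)⁆⁆ - ⁅(b : g), ⁅D.Z, (a : g)⁆⁆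
    rw [leibniz_lie, ← lie_skew (b : g), sub_neg_eq_add, add_comm]

/-- Derivations of s are inner, so ad(Z) restricted to s is ad(W) for some W in s. -/
lemma existsUnique_isComplexStructure (hZ : ∀ X ∈ s, ⁅D.Z, X⁆ ∈ s)
    (hc : ∀ X ∈ s, (∀ Y ∈ s, ⁅X, Y⁆ = 0) → X = 0) :
    ∃! Z' : s, IsComplexStructure (D.k.comap s.incl) (D.p.comap s.toSubmodule.subtype) Z' ∧
      IsHolomorphic Z' D.Z s.incl := by
  have := D.isKilling_of_lie_Z_mem hZ hc
  obtain ⟨W, hW⟩ := LieDerivation.IsKilling.exists_eq_ad (D.derivationZ hZ)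
  have hWZ : ∀ X : s, ⁅(W : g), (X : g)⁆ = ⁅D.Z, (X : g)⁆ := fun X ↦ by
    have h := DFunLike.congr_fun hW X
    rw [LieDerivation.ad_apply_apply] at h
    exact congrArg Subtype.val h
  refine ⟨W, ⟨⟨?_, fun X hX ↦ ?_, fun X hX ↦ ?_⟩, hWZ⟩, fun V hV ↦ ?_⟩
  -- [Z, W] = [W, W] = 0, so ad(Z) kills the p-component v of W; since ad(Z)² = -1 on p, v = 0.
  · obtain ⟨u, hu, v, hv, huv⟩ := D.exists_add (W : g)
    have h := hWZ W
    rw [lie_self, ← huv, lie_add, D.lie_Z_of_mem_k hu, zero_add] at h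
    have h' := D.lie_lie_Z_of_mem_p hv
    rw [← h, lie_zero, eq_comm, neg_eq_zero] at h'
    change (W : g) ∈ D.k
    rwa [← huv, h', add_zero]
  · exact Subtype.ext ((hWZ X).trans (D.lie_Z_of_mem_k hX))
  · refine Subtype.ext ((hWZ _).trans ?_)
    change ⁅D.Z, ⁅(W : g), (X : g)⁆⁆ = _
    rw [hWZ]
    exact D.lie_lie_Z_of_mem_p hX
  -- Both V and W act on s as ad(Z), so their difference is central in s.
  · refine sub_eq_zero.mp (Subtype.ext (hc _ (V - W).2 fun Y hY ↦ ?_))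
    have h : ⁅(V : g), Y⁆ = ⁅D.Z, Y⁆ := hV.2 ⟨Y, hY⟩
    change ⁅(V : g) - W, Y⁆ = 0
    rw [sub_lie, h, hWZ ⟨Y, hY⟩, sub_self]

end StableSubalgebra

/-! ### Root spaces and the regular subalgebra -/

section RegularSubalgebra

open LieAlgebra LieAlgebra.IsKilling LieModule

variable {g : Type*} [LieRing g] [LieAlgebra ℝ g] [FiniteDimensional ℝ g]
  [LieAlgebra.IsSemisimple ℝ g] (D : HermitianDatum g)

/-- For H in h, ad(H) commutes with conjugation, while its eigenvalue α(H) is imaginary and so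
changes sign. -/
lemma conj_mem_rootSpace_neg (α : Weight ℂ D.hC (ℂ ⊗[ℝ] g)) {x : ℂ ⊗[ℝ] g}
    (hx : x ∈ rootSpace D.hC α) : conj x ∈ rootSpace D.hC (-α) := by
  rcases eq_or_ne x 0 with rfl | hx0
  · have h0 : conj (0 : ℂ ⊗[ℝ] g) = 0 := by simp [conj]
    rw [h0]
    exact zero_mem _
  refine weightSpace_le_genWeightSpace _ _ ((mem_weightSpace _ _).mpr ?_)
  have key : ∀ H (hH : H ∈ D.h), ⁅(1 : ℂ) ⊗ₜ[ℝ] H, conj x⁆ =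
      -α ⟨_, D.one_tmul_mem_hC hH⟩ • conj x := fun H hH ↦ by
    have h : ⁅(1 : ℂ) ⊗ₜ[ℝ] H, x⁆ = α ⟨_, D.one_tmul_mem_hC hH⟩ • x :=
      lie_eq_smul_of_mem_rootSpace hx ⟨_, D.one_tmul_mem_hC hH⟩
    have hα := D.re_eq_zero_of_lie_eq_smul (D.maximal_h.prop.1 hH) hx0 h
    have hre := congrArg rePart h
    have him := congrArg imPart h
    simp only [rePart_lie, imPart_lie, rePart_tmul, imPart_tmul, rePart_smul, imPart_smul,
      Complex.one_re, Complex.one_im, one_smul, zero_smul, zero_lie, sub_zero, add_zero, zero_sub,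
      zero_add, hα] at hre him
    refine ext_rePart_imPart ?_ ?_ <;> simp [hα, hre, him]
  -- Both sides are ℂ-linear in y, so the real case `key` extends from h to h_ℂ.
  rintro ⟨y, hy⟩
  obtain ⟨hr, hi⟩ := (mem_complexify_iff _ _).mp hy
  have hy' : (⟨y, hy⟩ : D.hC) = ⟨_, D.one_tmul_mem_hC hr⟩ +
      Complex.I • ⟨_, D.one_tmul_mem_hC hi⟩ :=
    Subtype.ext <| (eq_rePart_add_imPart y).trans <| by simp [TensorProduct.smul_tmul']
  have hα : α ⟨y, hy⟩ = α ⟨_, D.one_tmul_mem_hC hr⟩ +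
      Complex.I * α ⟨_, D.one_tmul_mem_hC hi⟩ := by
    have h := congrArg α.toLinear hy'
    rwa [map_add, map_smul] at h
  have h1 := key _ hr
  have h2 := key _ hi
  change ⁅y, conj x⁆ = -α ⟨y, hy⟩ • conj x
  have hy2 : y = (1 : ℂ) ⊗ₜ[ℝ] rePart y + Complex.I • ((1 : ℂ) ⊗ₜ[ℝ] imPart y) :=
    congrArg Subtype.val hy'
  rw [hα]
  conv_lhs => rw [hy2]
  have h3 : ⁅Complex.I • ((1 : ℂ) ⊗ₜ[ℝ] imPart y), conj x⁆ =
      Complex.I • ⁅(1 : ℂ) ⊗ₜ[ℝ] imPart y, conj x⁆ := by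
    refine ext_rePart_imPart ?_ ?_ <;> simp
  rw [add_lie, h3, h1, h2]
  module

variable (Γ : Set D.hC.root)

lemma exists_neg_mem_subrootSystem {Γ : Set D.hC.root} {α : D.hC.root}
    (hα : α ∈ subrootSystem Γ) : ∃ β ∈ subrootSystem Γ,
      ((β : Weight ℂ D.hC (ℂ ⊗[ℝ] g)) : D.hC → ℂ) = -(α : Weight ℂ D.hC (ℂ ⊗[ℝ] g)) := by
  refine ⟨⟨-(α : Weight ℂ D.hC (ℂ ⊗[ℝ] g)), ?_⟩, ?_, rfl⟩
  · simpa using D.hC.isNonZero_coe_root α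
  · have h : rootForm α ∈ Submodule.span ℤ (rootForm '' Γ) := hα
    exact neg_mem h

/-- Subspaces of the complexification that contain the root spaces of `Δ(Γ)` and the brackets of
opposite ones contain the regular subalgebra. -/
lemma regularSubmodule_le_of_lie_mem {Γ : Set D.hC.root} {S : Submodule ℂ (ℂ ⊗[ℝ] g)}
    (h₁ : ∀ α ∈ subrootSystem Γ, ∀ x ∈ rootSpace D.hC (α : Weight ℂ D.hC (ℂ ⊗[ℝ] g)), x ∈ S)
    (h₂ : ∀ x ∈ regularSubmodule Γ, ∀ y ∈ regularSubmodule Γ, x ∈ S → y ∈ S → ⁅x, y⁆ ∈ S) :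
    regularSubmodule Γ ≤ S := by
  refine regularSubmodule_le (fun α hα ↦ ?_) h₁
  -- The coroot of α is a combination of brackets of the α and -α root spaces.
  refine Submodule.span_le.mpr ?_ ((mem_corootSpace _).mp (coroot_mem_corootSpace
    (α : Weight ℂ D.hC (ℂ ⊗[ℝ] g))))
  rintro _ ⟨y, hy, z, hz, rfl⟩
  obtain ⟨β, hβ, hβα⟩ := D.exists_neg_mem_subrootSystem hα
  rw [← hβα] at hz
  exact h₂ _ (rootSpace_le_regularSubmodule hα hy) _ (rootSpace_le_regularSubmodule hβ hz)
    (h₁ α hα y hy) (h₁ β hβ z hz)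

/-- Δ(Γ) = -Δ(Γ), so the conjugate of a root vector stays in 𝔤_ℂ(Γ), and its real and imaginary
parts lie in 𝔤(Γ). -/
lemma regularSubalgebra_le_complexify :
    regularSubalgebra Γ ≤ complexify (D.realRegularSubalgebra Γ) := by
  refine D.regularSubmodule_le_of_lie_mem (S := (complexify (D.realRegularSubalgebra Γ)).toSubmodule)
    (fun α hα x hx ↦ ?_) (fun x _ y _ hx hy ↦ LieSubalgebra.lie_mem _ hx hy)
  obtain ⟨β, hβ, hβα⟩ := D.exists_neg_mem_subrootSystem hα
  have hx' := D.conj_mem_rootSpace_neg _ hx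
  rw [← hβα] at hx'
  have h1 : x ∈ regularSubalgebra Γ := rootSpace_le_regularSubmodule hα hx
  have h2 : conj x ∈ regularSubalgebra Γ := rootSpace_le_regularSubmodule hβ hx'
  exact (mem_complexify_iff _ _).mpr ⟨rePart_mem_realPart h1 h2, imPart_mem_realPart h1 h2⟩

/-- All of h_ℂ normalizes 𝔤_ℂ(Γ), not just the span of the coroots; this is applied to Z. -/
lemma lie_mem_regularSubmodule_of_mem_hC {y x : ℂ ⊗[ℝ] g} (hy : y ∈ D.hC)
    (hx : x ∈ regularSubmodule Γ) : ⁅y, x⁆ ∈ regularSubmodule Γ := by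
  have h : regularSubmodule Γ ≤ (regularSubmodule Γ).comap
      (ad ℂ (ℂ ⊗[ℝ] g) y : ℂ ⊗[ℝ] g →ₗ[ℂ] ℂ ⊗[ℝ] g) := by
    refine D.regularSubmodule_le_of_lie_mem (fun α hα v hv ↦ ?_) fun u hu v hv hu' hv' ↦ ?_
    · have h : ⁅y, v⁆ = _ := lie_eq_smul_of_mem_rootSpace hv ⟨y, hy⟩
      rw [Submodule.mem_comap, ad_apply, h]
      exact Submodule.smul_mem _ _ (rootSpace_le_regularSubmodule hα hv)
    · rw [Submodule.mem_comap, ad_apply] at hu' hv' ⊢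
      rw [leibniz_lie]
      exact add_mem (lie_mem_regularSubmodule hu' hv) (lie_mem_regularSubmodule hu hv')
  exact h hx

lemma lie_Z_mem_realRegularSubalgebra {X : g} (hX : X ∈ D.realRegularSubalgebra Γ) :
    ⁅D.Z, X⁆ ∈ D.realRegularSubalgebra Γ := by
  have h := D.lie_mem_regularSubmodule_of_mem_hC Γ (D.one_tmul_mem_hC D.Z_mem_h) hX
  rwa [LieAlgebra.ExtendScalars.bracket_tmul, one_mul] at h

/-- The subalgebra `𝔤(Γ)` has trivial centre. -/
lemma eq_zero_of_forall_lie_realRegularSubalgebra {X : g} (hX : X ∈ D.realRegularSubalgebra Γ)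
    (hc : ∀ Y ∈ D.realRegularSubalgebra Γ, ⁅X, Y⁆ = 0) : X = 0 := by
  -- S is the complexified Killing-orthogonal of X. By invariance it contains all brackets of
  -- elements of 𝔤_ℂ(Γ).
  let S := (LinearMap.ker (killingForm ℝ g X)).baseChange ℂ
  have hlie : ∀ x ∈ regularSubmodule Γ, ∀ y ∈ regularSubmodule Γ, ⁅x, y⁆ ∈ S := by
    intro x hx y hy
    obtain ⟨h1, h2⟩ := (mem_complexify_iff _ _).mp (D.regularSubalgebra_le_complexify Γ hx)
    have h : ∀ u ∈ D.realRegularSubalgebra Γ, ∀ v, killingForm ℝ g X ⁅u, v⁆ = 0 := by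
      intro u hu v
      rw [killingForm, ← LieModule.traceForm_apply_lie_apply, hc u hu, map_zero,
        LinearMap.zero_apply]
    refine (mem_baseChange_iff _ _).mpr ⟨?_, ?_⟩
    · rw [rePart_lie]
      exact sub_mem (h _ h1 _) (h _ h2 _)
    · rw [imPart_lie]
      exact add_mem (h _ h1 _) (h _ h2 _)
  have hle : regularSubmodule Γ ≤ S := by
    refine D.regularSubmodule_le_of_lie_mem (fun α hα x hx ↦ ?_) fun x hx y hy _ _ ↦ hlie x hx y hy
    have hα0 : (α : Weight ℂ D.hC (ℂ ⊗[ℝ] g)).IsNonZero := D.hC.isNonZero_coe_root α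
    have h : ⁅((coroot (α : Weight ℂ D.hC (ℂ ⊗[ℝ] g)) : D.hC) : ℂ ⊗[ℝ] g), x⁆ = _ :=
      lie_eq_smul_of_mem_rootSpace hx (coroot (α : Weight ℂ D.hC (ℂ ⊗[ℝ] g)))
    -- α takes the value 2 on its coroot, so each root vector is half its own bracket with the
    -- coroot.
    rw [root_apply_coroot hα0] at h
    have h' := hlie _ (coroot_mem_regularSubmodule hα) _ (rootSpace_le_regularSubmodule hα hx)
    rw [h] at h'
    exact (Submodule.smul_mem_iff _ two_ne_zero).mp h'
  by_contra h0
  have h := D.innerForm_pos h0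
  -- θX again lies in 𝔤(Γ), so the squared length -B(X, θX) of X vanishes.
  have hm : D.cartanInvolution X ∈ D.realRegularSubalgebra Γ :=
    D.cartanInvolution_mem (fun Y hY ↦ D.lie_Z_mem_realRegularSubalgebra Γ hY) hX
  have h1 := ((mem_baseChange_iff _ _).mp (hle hm)).1
  rw [rePart_tmul, Complex.one_re, one_smul, LinearMap.mem_ker] at h1
  rw [innerForm_apply, h1, neg_zero] at h
  exact h.false

end RegularSubalgebra

end HermitianDatum

end HermitianLie

theorem mainTheorem2 {g : Type*} [LieRing g] [LieAlgebra ℝ g] [FiniteDimensional ℝ g]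
    [LieAlgebra.IsSemisimple ℝ g] (D : HermitianLie.HermitianDatum g)
    (Γ : Set D.hC.root) (hΓ : HermitianLie.IsPiSystem Γ) :
    HermitianLie.IsHermitianType (D.realRegularSubalgebra Γ) ∧
    HermitianLie.IsCartanDecomposition
      (D.k.comap (D.realRegularSubalgebra Γ).incl)
      (D.p.comap (D.realRegularSubalgebra Γ).toSubmodule.subtype) ∧
    ∃! Z' : D.realRegularSubalgebra Γ,
      HermitianLie.IsComplexStructure
        (D.k.comap (D.realRegularSubalgebra Γ).incl)
        (D.p.comap (D.realRegularSubalgebra Γ).toSubmodule.subtype) Z' ∧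
      HermitianLie.IsHolomorphic Z' D.Z (D.realRegularSubalgebra Γ).incl := by
  have hZ := fun X ↦ D.lie_Z_mem_realRegularSubalgebra Γ (X := X)
  have hc := fun X ↦ D.eq_zero_of_forall_lie_realRegularSubalgebra Γ (X := X)
  have hk := D.isKilling_of_lie_Z_mem hZ hc
  have hcd := D.isCartanDecomposition_of_lie_Z_mem hZ hc
  have hex := D.existsUnique_isComplexStructure hZ hc
  obtain ⟨Z', hZ', -⟩ := hex.exists
  exact ⟨⟨inferInstance, _, _, Z', hcd, hZ'⟩, hcd, hex⟩
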